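/- Let $1\le n\le m$ be integers, let $q$ be a prime power, and let $\mathbb F_q$ be the field with $q$ elements. A code is an $\mathbb F_q$-linear subspace $\mathcal C\subseteq\mathbb F_q^{m\times n}$, and $\mathrm{maxrk}(\mathcal C)=\max\{\mathrm{rk}(M):M\in\mathcal C\}$. A code $\mathcal A\subseteq\mathbb F_q^{m\times n}$ is an optimal anticode if $\dim\mathcal A=m\cdot\mathrm{maxrk}(\mathcal A)$. The weight of a code $\mathcal C$ is $$\mathrm{wt}(\mathcal C)=\min\{\mathrm{maxrk}(\mathcal A):\mathcal C\subseteq\mathcal A\subseteq\mathbb F_q^{m\times n},\ \mathcal A\text{ an optimal anticode}\},$$ and for $1\le r\le\dim\mathcal C$ the $r$-th generalized rank weight of $\mathcal C$ is $$d_r(\mathcal C)=\min\{\mathrm{wt}(\mathcal D):\mathcal D\subseteq\mathcal C\text{ a linear subspace with }\dim\mathcal D\ge r\}.$$ Let $d_1\le d_2\le\dots\le d_k$ be a non-decreasing sequence of positive integers. There exists a code $\mathcal C\subseteq\mathbb F_q^{m\times n}$ with $\dim\mathcal C=k$ and $d_r(\mathcal C)=d_r$ for all $1\le r\le k$ if and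 only if $k\le mn$, $d_k\le n$, and every constant subsequence of $d_1,\dots,d_k$ has length at most $m$. (For $k=0$ the sequence is empty and the condition $d_k\le n$ is void.) -/

import Mathlib

/-! Rank-metric codes in the space of `m × n` matrices over a field `F`, in the convention `n ≤ m`
(at least as many rows as columns). A code is an `F`-linear subspace. -/

namespace RankMetric

variable {F : Type*} [Field F] {m n : ℕ}

/-- The maximum rank of the matrices in the code `C`. -/
noncomputable def maxRank (C : Submodule F (Matrix (Fin m) (Fin n) F)) : ℕ :=
  sSup {r : ℕ | ∃ M ∈ C, M.rank = r}

/-- An optimal anticode is a code attaining the bound `dim A ≤ m * maxRank A`. -/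
def IsOptimalAnticode (A : Submodule F (Matrix (Fin m) (Fin n) F)) : Prop :=
  Module.finrank F A = m * maxRank A

/-- The weight of a code: the least maximum rank of an optimal anticode containing it. -/
noncomputable def weight (C : Submodule F (Matrix (Fin m) (Fin n) F)) : ℕ :=
  sInf {w : ℕ | ∃ A : Submodule F (Matrix (Fin m) (Fin n) F),
    C ≤ A ∧ IsOptimalAnticode A ∧ maxRank A = w}

/-- The `r`-th generalized rank weight of a code, meaningful for `1 ≤ r ≤ dim C`: the least weight
of a subcode of dimension at least `r`. -/
noncomputable def genWeight (C : Submodule F (Matrix (Fin m) (Fin n) F)) (r : ℕ) : ℕ :=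
  sInf {w : ℕ | ∃ D : Submodule F (Matrix (Fin m) (Fin n) F),
    D ≤ C ∧ r ≤ Module.finrank F D ∧ weight D = w}

/-- The finite sequence `d` (indexed from `0`) is the sequence of all generalized rank weights
`d_1(C), …, d_k(C)` of the code `C`, where `k = dim C`. -/
def IsGenWeightSequence (C : Submodule F (Matrix (Fin m) (Fin n) F)) {k : ℕ}
    (d : Fin k → ℕ) : Prop :=
  Module.finrank F C = k ∧ ∀ i : Fin k, genWeight C ((i : ℕ) + 1) = d i

/-- The supremum defining `maxRank` is a maximum. -/
theorem isGreatest_maxRank (C : Submodule F (Matrix (Fin m) (Fin n) F)) :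
    IsGreatest {r : ℕ | ∃ M ∈ C, M.rank = r} (maxRank C) := by
  have hb : BddAbove {r : ℕ | ∃ M ∈ C, M.rank = r} := by
    refine ⟨n, ?_⟩
    rintro r ⟨M, -, rfl⟩
    exact M.rank_le_width
  exact ⟨Nat.sSup_mem ⟨_, 0, C.zero_mem, rfl⟩ hb, fun r hr => le_csSup hb hr⟩

/-- The whole space has maximum rank `n`, when `n ≤ m`. -/
theorem maxRank_top (h : n ≤ m) :
    maxRank (⊤ : Submodule F (Matrix (Fin m) (Fin n) F)) = n := by
  refine (isGreatest_maxRank _).unique ⟨?_, ?_⟩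
  · refine ⟨Matrix.of fun i j => if i = Fin.castLE h j then 1 else 0, trivial, ?_⟩
    apply le_antisymm (Matrix.rank_le_width _)
    have hs : (Matrix.of fun (i : Fin m) (j : Fin n) =>
        if i = Fin.castLE h j then (1 : F) else 0).submatrix (Fin.castLE h) id = 1 := by
      ext i j
      simp [Matrix.one_apply, (Fin.castLE_injective h).eq_iff]
    have := Matrix.rank_submatrix_le (Matrix.of fun (i : Fin m) (j : Fin n) =>
        if i = Fin.castLE h j then (1 : F) else 0) (Fin.castLE h) id
    rw [hs, Matrix.rank_one, Fintype.card_fin] at this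
    exact this
  · rintro r ⟨M, -, rfl⟩
    exact M.rank_le_width

/-- The whole space is an optimal anticode, so every code has a weight, when `n ≤ m`. -/
theorem isOptimalAnticode_top (h : n ≤ m) :
    IsOptimalAnticode (⊤ : Submodule F (Matrix (Fin m) (Fin n) F)) := by
  simp [IsOptimalAnticode, maxRank_top h, Module.finrank_matrix]

/-- The infimum defining `weight` is a minimum, when `n ≤ m`. -/
theorem isLeast_weight (h : n ≤ m) (C : Submodule F (Matrix (Fin m) (Fin n) F)) :
    IsLeast {w : ℕ | ∃ A : Submodule F (Matrix (Fin m) (Fin n) F),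
      C ≤ A ∧ IsOptimalAnticode A ∧ maxRank A = w} (weight C) :=
  ⟨Nat.sInf_mem ⟨_, ⊤, le_top, isOptimalAnticode_top h, rfl⟩, fun _ hw => Nat.sInf_le hw⟩

/-- The infimum defining `genWeight` is a minimum, for `r ≤ dim C`. -/
theorem isLeast_genWeight (C : Submodule F (Matrix (Fin m) (Fin n) F)) {r : ℕ}
    (hr : r ≤ Module.finrank F C) :
    IsLeast {w : ℕ | ∃ D : Submodule F (Matrix (Fin m) (Fin n) F),
      D ≤ C ∧ r ≤ Module.finrank F D ∧ weight D = w} (genWeight C r) :=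
  ⟨Nat.sInf_mem ⟨_, C, le_rfl, hr, rfl⟩, fun _ hw => Nat.sInf_le hw⟩

end RankMetric

/-! Necessity rests on the strict growth d_r < d_{r+m} (`genWeight_lt_genWeight_add`). An optimal
anticode of maximum rank w+1 contains one of maximum rank w, hence of codimension m in it.
Intersecting a subcode that realizes d_{r+m} with the smaller anticode costs at most m dimensions
and lowers the weight, so no value can repeat more than m times. The smaller anticode comes from the
classification `le_finrank_commonKer_or_exists_range_le`: up to transposition when m = n, optimal
anticodes are all the maps that vanish on a fixed subspace.

For sufficiency, matrices become F-linear maps F^n → L with [L : F] = m. Two opposite flags of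
L-subspaces are used: E_w, the maps vanishing on the unit vectors e_l with l ≥ w (indexed from 0),
which are optimal anticodes; and the Gabidulin codes G_s, whose nonzero elements have kernels of
dimension less than s. Counting dimensions gives a nonzero g_j in G_{n-j} ∩ E_{j+1}, and the g_j are
L-independent. The code is spanned by multiples of g_{d_i - 1} by elements of an F-basis of L,
distinct for equal d_i; this is where m bounds the multiplicities. The flag E bounds the weights
from above, the flag G from below (`exists_code_of_fibers_card_le`). -/

open Module

namespace RankMetric

/-! ### Gabidulin codes -/

section Gabidulin

variable {F L V W : Type*} [Field F] [Fintype F] [Field L] [Algebra F L]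
  [AddCommGroup V] [Module F V]

/-- The composite of `α` with the `i`-th power of the relative Frobenius map of `L` over `F`. -/
noncomputable def frobComp (α : V →ₗ[F] L) (i : ℕ) : V →ₗ[F] L :=
  ((FiniteField.frobeniusAlgHom F L) ^ i).toLinearMap ∘ₗ α

theorem frobComp_apply (α : V →ₗ[F] L) (i : ℕ) (x : V) :
    frobComp α i x = α x ^ (Fintype.card F ^ i) := by
  simp only [frobComp, LinearMap.comp_apply, AlgHom.toLinearMap_apply, AlgHom.coe_pow,
    FiniteField.coe_frobeniusAlgHom, pow_iterate]

/-- A nonzero linearized polynomial with `s` coefficients has a kernel of dimension less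
than `s`. -/
theorem finrank_ker_sum_frobComp_lt [FiniteDimensional F V] {α : V →ₗ[F] L}
    (hα : Function.Injective α) {s : ℕ} {a : Fin s → L} (ha : a ≠ 0) :
    finrank F (LinearMap.ker (∑ i, a i • frobComp α i)) < s := by
  classical
  set q := Fintype.card F with hq
  have hq1 : 1 < q := Fintype.one_lt_card
  obtain ⟨i₀, hi₀⟩ := Function.ne_iff.1 ha
  -- The map sends x to P(α x), so α embeds its kernel, of size q ^ dim, in the root set of P, which
  -- has degree at most q ^ (s - 1).
  set P : Polynomial L := ∑ i, Polynomial.C (a i) * Polynomial.X ^ (q ^ (i : ℕ)) with hP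
  have hP0 : P ≠ 0 := by
    intro h
    have h1 : P.coeff (q ^ (i₀ : ℕ)) = a i₀ := by
      rw [hP, Polynomial.finsetSum_coeff, Finset.sum_eq_single i₀]
      · simp
      · intro j _ hj
        rw [Polynomial.coeff_C_mul_X_pow, if_neg]
        intro h2
        exact hj (Fin.ext (Nat.pow_right_injective hq1 h2).symm)
      · simp
    rw [h] at h1
    exact hi₀ h1.symm
  have hdeg : P.natDegree ≤ q ^ (s - 1) := by
    refine Polynomial.natDegree_sum_le_of_forall_le _ _ fun i _ => ?_
    refine (Polynomial.natDegree_C_mul_X_pow_le _ _).trans ?_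
    exact Nat.pow_le_pow_right hq1.le (by omega)
  set K := LinearMap.ker (∑ i, a i • frobComp α i)
  have : Finite K := Module.finite_of_finite F
  have := Fintype.ofFinite K
  let Z : Finset L := Finset.univ.image fun x : K => α x
  have hZ : Z.card = q ^ finrank F K := by
    exact (Finset.card_image_of_injective _ (hα.comp Subtype.val_injective)).trans
      (Finset.card_univ.trans (Module.card_eq_pow_finrank (K := F)))
  have hle : Z.card ≤ P.natDegree := by
    refine Polynomial.card_le_degree_of_subset_roots fun y hy => ?_
    obtain ⟨x, -, rfl⟩ := Finset.mem_image.1 hy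
    rw [Polynomial.mem_roots hP0, Polynomial.IsRoot.def, hP, Polynomial.eval_finsetSum]
    have hx := x.2
    rw [LinearMap.mem_ker, LinearMap.sum_apply] at hx
    simpa [frobComp_apply] using hx
  have := (Nat.pow_le_pow_iff_right hq1).1 (hZ ▸ hle.trans hdeg)
  have := i₀.2
  omega

/-- The code of the linearized polynomials with `s` coefficients, evaluated along `α`. -/
noncomputable def gabidulin (α : V →ₗ[F] L) (s : ℕ) : Submodule L (V →ₗ[F] L) :=
  Submodule.span L (Set.range fun i : Fin s => frobComp α i)

theorem gabidulin_mono (α : V →ₗ[F] L) {s t : ℕ} (h : s ≤ t) : gabidulin α s ≤ gabidulin α t := by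
  refine Submodule.span_mono ?_
  rintro _ ⟨i, rfl⟩
  exact ⟨Fin.castLE h i, rfl⟩

variable [FiniteDimensional F V]

theorem finrank_ker_lt_of_mem_gabidulin {α : V →ₗ[F] L} (hα : Function.Injective α) {s : ℕ}
    {f : V →ₗ[F] L} (hf : f ∈ gabidulin α s) (h0 : f ≠ 0) :
    finrank F (LinearMap.ker f) < s := by
  obtain ⟨a, rfl⟩ := (Submodule.mem_span_range_iff_exists_fun L).1 hf
  refine finrank_ker_sum_frobComp_lt hα ?_
  rintro rfl
  simp at h0

theorem finrank_gabidulin {α : V →ₗ[F] L} (hα : Function.Injective α) {s : ℕ}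
    (hs : s ≤ finrank F V) : finrank L (gabidulin α s) = s := by
  rw [gabidulin, finrank_span_eq_card, Fintype.card_fin]
  rw [Fintype.linearIndependent_iff]
  intro a ha
  by_contra! h
  have := finrank_ker_sum_frobComp_lt hα (a := a) (Function.ne_iff.2 h)
  rw [ha, LinearMap.ker_zero, finrank_top] at this
  omega

/-- A nonzero element of this Gabidulin code has kernel of dimension less than dim V - w, hence rank
greater than w. -/
theorem disjoint_gabidulin {α : V →ₗ[F] L} (hα : Function.Injective α) {w : ℕ}
    {A : Submodule F (V →ₗ[F] L)} (hA : ∀ f ∈ A, finrank F (LinearMap.range f) ≤ w) :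
    Disjoint A ((gabidulin α (finrank F V - w)).restrictScalars F) := by
  rw [Submodule.disjoint_def]
  intro f hf hf'
  by_contra h0
  have h1 := finrank_ker_lt_of_mem_gabidulin hα hf' h0
  have h2 := hA f hf
  have h3 := f.finrank_range_add_finrank_ker
  omega

theorem finrank_restrictScalars_gabidulin [FiniteDimensional F L] {α : V →ₗ[F] L}
    (hα : Function.Injective α) {s : ℕ} (hs : s ≤ finrank F V) :
    finrank F ((gabidulin α s).restrictScalars F) = finrank F L * s := by
  have : Module.Free L (gabidulin α s) := Module.Free.of_divisionRing L (gabidulin α s)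
  exact (Module.finrank_mul_finrank F L (gabidulin α s)).symm.trans
    (by rw [finrank_gabidulin hα hs])

end Gabidulin

/-! ### The anticode bound -/

/-- A finite field has a field extension of every positive degree. -/
theorem exists_extension_finrank_eq (F : Type*) [Field F] [Finite F] {m : ℕ} (hm : 0 < m) :
    ∃ (L : Type) (_ : Field L) (_ : Algebra F L), FiniteDimensional F L ∧ finrank F L = m := by
  obtain ⟨p, hp⟩ := CharP.exists F
  have : Fact p.Prime := ⟨CharP.char_is_prime F p⟩
  have : NeZero m := ⟨hm.ne'⟩
  exact ⟨FiniteField.Extension F p m, inferInstance, inferInstance, inferInstance,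
    FiniteField.finrank_extension F p m⟩

/-- The dimension of a space of linear maps of rank at most `w` is at most `w` times the dimension
of the codomain, if the latter is at least the dimension of the domain. -/
theorem finrank_le_of_forall_finrank_range_le {F V W : Type*} [Field F] [Finite F]
    [AddCommGroup V] [Module F V] [FiniteDimensional F V]
    [AddCommGroup W] [Module F W] [FiniteDimensional F W] (hVW : finrank F V ≤ finrank F W) {w : ℕ} {A : Submodule F (V →ₗ[F] W)}
    (hA : ∀ f ∈ A, finrank F (LinearMap.range f) ≤ w) : finrank F A ≤ w * finrank F W := by
  have := Fintype.ofFinite F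
  rcases le_or_gt (finrank F V) w with h | h
  · calc finrank F A ≤ finrank F (V →ₗ[F] W) := A.finrank_le
      _ = finrank F V * finrank F W := finrank_linearMap ..
      _ ≤ _ := Nat.mul_le_mul_right _ h
  obtain ⟨L, _, _, _, hL⟩ := exists_extension_finrank_eq F (m := finrank F W) (by omega)
  obtain ⟨e⟩ := FiniteDimensional.nonempty_linearEquiv_of_finrank_eq hL.symm
  obtain ⟨α, hα⟩ := finrank_le_iff_exists_linearMap.1 (hVW.trans hL.ge)
  let E : (V →ₗ[F] W) ≃ₗ[F] (V →ₗ[F] L) := LinearEquiv.congrRight e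
  -- The Gabidulin code of parameter dim V - w has codimension w * dim W, which bounds any space
  -- disjoint from it.
  have hd := disjoint_gabidulin hα (w := w) (A := A.map E.toLinearMap) (by
    rintro _ ⟨f, hf, rfl⟩
    have : LinearMap.range (E f) = (LinearMap.range f).map e.toLinearMap :=
      LinearMap.range_comp f e.toLinearMap
    change finrank F (LinearMap.range (E f)) ≤ w
    rw [this]
    exact (Submodule.finrank_map_le _ _).trans (hA f hf))
  have h1 := Submodule.finrank_add_finrank_le_of_disjoint hd
  rw [finrank_restrictScalars_gabidulin hα (Nat.sub_le _ _), finrank_linearMap, hL, LinearEquiv.finrank_map_eq] at h1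
  obtain ⟨c, hc⟩ := Nat.exists_eq_add_of_lt h
  rw [hc, show w + c + 1 - w = c + 1 by omega] at h1
  linarith

/-! ### Classification of optimal anticodes: evaluation maps, slices, restrictions -/

section Classification

variable {F V W : Type*} [Field F]
  [AddCommGroup V] [Module F V] [AddCommGroup W] [Module F W]

theorem exists_linearIndependent_apply_zero_eq [FiniteDimensional F V] {v : V} (hv : v ≠ 0)
    (k : ℕ) (hk : k + 1 ≤ finrank F V) :
    ∃ f : Fin (k + 1) → V, LinearIndependent F f ∧ f 0 = v := by
  induction k with
  | zero => 
    refine ⟨fun _ => v, ?_, rfl⟩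
    rw [Fintype.linearIndependent_iff]
    intro g hg i
    rw [Fin.eq_zero i]
    simpa [hv] using hg
  | succ k ih =>
    obtain ⟨f, hf, h0⟩ := ih (by omega)
    obtain ⟨x, hx⟩ := exists_linearIndependent_snoc_of_lt_finrank hf (by omega)
    refine ⟨_, hx, ?_⟩
    rw [← Fin.castSucc_zero, Fin.snoc_castSucc, h0]

theorem exists_injective_apply_basis_eq [FiniteDimensional F W] {ι : Type*} [Finite ι]
    (b : Basis ι F V) (j : ι) {v : W} (hv : v ≠ 0) (h : finrank F V ≤ finrank F W) :
    ∃ X : V →ₗ[F] W, Function.Injective X ∧ X (b j) = v := by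
  classical
  have := Fintype.ofFinite ι
  have := Module.Finite.of_basis b
  have : Nontrivial V := ⟨b j, 0, b.ne_zero j⟩
  obtain ⟨k, hk⟩ := Nat.exists_eq_succ_of_ne_zero (finrank_pos (R := F) (M := V)).ne'
  obtain ⟨f, hf, h0⟩ := exists_linearIndependent_apply_zero_eq (F := F) hv k (by omega)
  have e : ι ≃ Fin (k + 1) :=
    Fintype.equivFinOfCardEq (by rw [← finrank_eq_card_basis b, hk])
  refine ⟨b.constr F (f ∘ Equiv.swap 0 (e j) ∘ e), ?_, ?_⟩
  · exact b.injective_constr_of_linearIndependent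
      (hf.comp _ ((Equiv.injective _).comp e.injective))
  · simp [h0]

theorem exists_forall_eq_smul_of_mem_span {f : V →ₗ[F] V} (h : ∀ v, f v ∈ F ∙ v) :
    ∃ a : F, ∀ v, f v = a • v := by
  obtain ⟨a, ha⟩ := LinearMap.exists_eq_smul_id_of_forall_notLinearIndependent (f := f) (by
    intro v hv
    rw [LinearIndependent.pair_iff] at hv
    obtain ⟨c, hc⟩ := Submodule.mem_span_singleton.1 (h v)
    have := (hv c (-1) (by rw [hc]; simp)).2
    simp at this)
  exact ⟨a, fun v => by rw [ha]; simp⟩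

theorem eq_sum_coord_smulRight {ι : Type*} [Fintype ι] (b : Basis ι F V) (X : V →ₗ[F] W) :
    X = ∑ i, (b.coord i).smulRight (X (b i)) := by
  ext x
  conv_lhs => rw [← b.sum_repr x, map_sum]
  simp

/-- A linear functional of linear maps that always takes a value in the range of an injective
argument is an evaluation map. -/
theorem exists_forall_eq_apply_of_mem_range [FiniteDimensional F V] [FiniteDimensional F W]
    (G : (V →ₗ[F] W) →ₗ[F] W) (hlt : finrank F V < finrank F W)
    (hG : ∀ X : V →ₗ[F] W, Function.Injective X → G X ∈ LinearMap.range X) :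
    ∃ c, ∀ X, G X = X c := by
  let b := finBasis F V
  have key : ∀ i, ∃ a : F, ∀ v, G ((b.coord i).smulRight v) = a • v := by
    intro i
    suffices h : ∀ v, (G ∘ₗ LinearMap.smulRightₗ (b.coord i)) v ∈ F ∙ v from
      exists_forall_eq_smul_of_mem_span h
    intro v
    rw [LinearMap.comp_apply, LinearMap.smulRightₗ_apply]
    by_contra hy
    set y := G ((b.coord i).smulRight v) with hy_def
    have hv : v ≠ 0 := by
      rintro rfl
      have : (b.coord i).smulRight (0 : W) = 0 := by ext; simp
      rw [hy_def, this, map_zero] at hy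
      exact hy (Submodule.zero_mem _)
    have hy0 : y ≠ 0 := by
      intro h
      rw [h] at hy
      exact hy (Submodule.zero_mem _)
    by_cases hj : ∃ j, j ≠ i
    · obtain ⟨j, hj⟩ := hj
      have hdis : Disjoint (F ∙ v) (F ∙ y) := by
        rw [Submodule.disjoint_span_singleton' hy0]
        exact hy
      -- The hyperplane U contains v but not y, and has room for an injective X₁ from V since dim V
      -- < dim W. X₂ is X₁ after the transvection x ↦ x + b_i*(x) b_j, so it is injective into U
      -- too; then y = G X₂ - G X₁ would lie in U.
      obtain ⟨U, hvU, hU⟩ := hdis.exists_isCompl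
      have hfin := Submodule.finrank_add_eq_of_isCompl hU
      rw [finrank_span_singleton hy0] at hfin
      have hvU' : v ∈ U := hvU (Submodule.mem_span_singleton_self v)
      obtain ⟨X, hX, hXj⟩ := exists_injective_apply_basis_eq (W := U) b j (v := ⟨v, hvU'⟩)
        (by simpa using hv) (by omega)
      let X₁ : V →ₗ[F] W := U.subtype ∘ₗ X
      have hX₁ : Function.Injective X₁ := U.injective_subtype.comp hX
      have hX₁j : X₁ (b j) = v := by simp [X₁, hXj]
      let X₂ : V →ₗ[F] W := X₁ + (b.coord i).smulRight v
      have hX₂ : Function.Injective X₂ := by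
        rw [← LinearMap.ker_eq_bot, LinearMap.ker_eq_bot']
        intro x hx
        have h1 : X₁ (x + b.coord i x • b j) = X₁ 0 := by
          rw [map_add, map_smul, hX₁j, map_zero]
          exact hx
        have h2 := hX₁ h1
        have h3 : b.coord i x = 0 := by
          have := congrArg (b.coord i) h2
          simpa [Finsupp.single_apply, hj] using this
        rwa [h3, zero_smul, add_zero] at h2
      have hr : ∀ x, X₁ x ∈ U := fun x => (X x).2
      have m₁ : G X₁ ∈ U := by
        obtain ⟨x, hx⟩ := hG X₁ hX₁
        rw [← hx]
        exact hr x
      have m₂ : G X₂ ∈ U := by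
        obtain ⟨x, hx⟩ := hG X₂ hX₂
        rw [← hx]
        exact U.add_mem (hr x) (U.smul_mem _ hvU')
      have m₃ : y ∈ U := by
        have : y = G X₂ - G X₁ := by simp [X₂, hy_def]
        rw [this]
        exact U.sub_mem m₂ m₁
      exact hy0 (Submodule.disjoint_def.1 hU.disjoint y m₃ (Submodule.mem_span_singleton_self y))
    · push Not at hj
      have hinj : Function.Injective ((b.coord i).smulRight v) := by
        rw [← LinearMap.ker_eq_bot, LinearMap.ker_eq_bot']
        intro x hx
        rw [LinearMap.smulRight_apply, smul_eq_zero_iff_left hv] at hx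
        refine b.ext_elem fun j => ?_
        rw [hj j]
        simpa using hx
      obtain ⟨x, hx⟩ := hG _ hinj
      exact hy (Submodule.mem_span_singleton.2 ⟨_, hx⟩)
  choose a ha using key
  refine ⟨∑ i, a i • b i, fun X => ?_⟩
  conv_lhs => rw [eq_sum_coord_smulRight b X, map_sum]
  simp [ha]

/-- The vectors annihilated by all the maps in `A`. -/
def commonKer (A : Submodule F (V →ₗ[F] W)) : Submodule F V where
  carrier := {x | ∀ f ∈ A, f x = 0}
  add_mem' hx hy f hf := by rw [map_add, hx f hf, hy f hf, add_zero]
  zero_mem' f _ := map_zero f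
  smul_mem' c x hx f hf := by rw [map_smul, hx f hf, smul_zero]

/-- The vectors `v` such that `A` contains the map `x ↦ φ x • v`. -/
def slice (A : Submodule F (V →ₗ[F] W)) (φ : Dual F V) : Submodule F W :=
  A.comap (LinearMap.smulRightₗ φ)

theorem mem_slice {A : Submodule F (V →ₗ[F] W)} {φ : Dual F V} {v : W} :
    v ∈ slice A φ ↔ φ.smulRight v ∈ A := Iff.rfl

/-- The space of the restrictions of the maps in `A` to the kernel of `φ`. -/
def restrictKer (A : Submodule F (V →ₗ[F] W)) (φ : Dual F V) :
    Submodule F (LinearMap.ker φ →ₗ[F] W) :=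
  A.map (LinearMap.domRestrict' (LinearMap.ker φ))

theorem finrank_map_add_finrank_inf_ker [FiniteDimensional F V] (A : Submodule F V)
    (f : V →ₗ[F] W) :
    finrank F (A.map f) + finrank F (A ⊓ LinearMap.ker f : Submodule F V) = finrank F A := by
  have h := (f.domRestrict A).finrank_range_add_finrank_ker
  rw [LinearMap.range_domRestrict, LinearMap.ker_domRestrict,
    ← Submodule.finrank_map_subtype_eq A, Submodule.map_comap_subtype] at h
  exact h

theorem finrank_map_eq_of_injective {f : V →ₗ[F] W} (hf : Function.Injective f)
    (A : Submodule F V) : finrank F (A.map f) = finrank F A :=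
  (Submodule.equivMapOfInjective f hf A).finrank_eq.symm

/-- Rank-nullity for restriction to the hyperplane: a map that vanishes on ker φ is x ↦ φ x • f e
for any e with φ e = 1, so the slice is the kernel. -/
theorem finrank_restrictKer_add_finrank_slice [FiniteDimensional F V] [FiniteDimensional F W]
    (A : Submodule F (V →ₗ[F] W)) {φ : Dual F V} (hφ : φ ≠ 0) :
    finrank F (restrictKer A φ) + finrank F (slice A φ) = finrank F A := by
  obtain ⟨e, he⟩ : ∃ e, φ e = 1 := LinearMap.surjective hφ 1
  have hinj : Function.Injective (LinearMap.smulRightₗ φ : W →ₗ[F] V →ₗ[F] W) := by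
    intro v v' h
    have := LinearMap.congr_fun h e
    simpa [he] using this
  have heq : (slice A φ).map (LinearMap.smulRightₗ φ) =
      A ⊓ LinearMap.ker (LinearMap.domRestrict' (LinearMap.ker φ)) := by
    ext f
    constructor
    · rintro ⟨v, hv, rfl⟩
      refine ⟨hv, ?_⟩
      rw [SetLike.mem_coe, LinearMap.mem_ker]
      ext ⟨x, hx⟩
      simp [LinearMap.mem_ker.1 hx]
    · rintro ⟨hf, hker⟩
      have hfe : φ.smulRight (f e) = f := by
        ext x
        have hx : x - φ x • e ∈ LinearMap.ker φ := by simp [he]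
        have := LinearMap.congr_fun (LinearMap.mem_ker.1 hker) ⟨_, hx⟩
        have h2 : f (x - φ x • e) = 0 := this
        rw [map_sub, map_smul, sub_eq_zero] at h2
        exact h2.symm
      exact ⟨f e, by rwa [SetLike.mem_coe, mem_slice, hfe], hfe⟩
  rw [← finrank_map_add_finrank_inf_ker A (LinearMap.domRestrict' (LinearMap.ker φ)),
    ← finrank_map_eq_of_injective hinj, heq, restrictKer]

end Classification

/-! ### Classification: a hyperplane with trivial slice -/

section Classification

variable {F V W : Type*} [Field F]
  [AddCommGroup V] [Module F V] [AddCommGroup W] [Module F W]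

theorem map_commonKer_restrictKer_le (A : Submodule F (V →ₗ[F] W)) (φ : Dual F V) :
    (commonKer (restrictKer A φ)).map (LinearMap.ker φ).subtype ≤ commonKer A := by
  rintro _ ⟨x, hx, rfl⟩ f hf
  exact hx _ ⟨f, hf, rfl⟩

variable [FiniteDimensional F V]

theorem finrank_ker_dual_add_one {φ : Dual F V} (hφ : φ ≠ 0) :
    finrank F (LinearMap.ker φ) + 1 = finrank F V := by
  have h := φ.finrank_range_add_finrank_ker
  rw [LinearMap.range_eq_top.2 (LinearMap.surjective hφ), finrank_top, finrank_self] at h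
  omega

theorem exists_dual_apply_eq_one {u : V} (hu : u ≠ 0) : ∃ φ : Dual F V, φ u = 1 := by
  obtain ⟨φ, hφ⟩ : ∃ φ : Dual F V, φ u ≠ 0 := by
    by_contra! h
    exact hu ((forall_dual_apply_eq_zero_iff F u).1 h)
  exact ⟨(φ u)⁻¹ • φ, by simp [hφ]⟩

theorem finrank_range_le_of_mem_restrictKer {A : Submodule F (V →ₗ[F] W)} {w : ℕ}
    (hA : ∀ f ∈ A, finrank F (LinearMap.range f) ≤ w) (φ : Dual F V) :
    ∀ g ∈ restrictKer A φ, finrank F (LinearMap.range g) ≤ w := by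
  rintro _ ⟨f, hf, rfl⟩
  exact (Submodule.finrank_mono (LinearMap.range_domRestrict_le_range f _)).trans (hA f hf)

theorem finrank_commonKer_restrictKer_le (A : Submodule F (V →ₗ[F] W)) (φ : Dual F V) :
    finrank F (commonKer (restrictKer A φ)) ≤ finrank F (commonKer A) := by
  rw [← Submodule.finrank_map_subtype_eq]
  exact Submodule.finrank_mono (map_commonKer_restrictKer_le A φ)

variable [FiniteDimensional F W]

/-- If a space of maps of rank at most `w` restricts bijectively to all the maps on a hyperplane of
dimension `w`, then the maps have a common nonzero kernel vector. -/
theorem commonKer_ne_bot_of_slice_eq_bot {A : Submodule F (V →ₗ[F] W)} {w : ℕ}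
    (hVW : finrank F V ≤ finrank F W) (hw : finrank F V = w + 1)
    (hA : ∀ f ∈ A, finrank F (LinearMap.range f) ≤ w) (hdim : finrank F A = w * finrank F W)
    {φ : Dual F V} (hφ : φ ≠ 0) (hs : slice A φ = ⊥) : commonKer A ≠ ⊥ := by
  obtain ⟨e, he⟩ : ∃ e, φ e = 1 := LinearMap.surjective hφ 1
  have hH := finrank_ker_dual_add_one hφ
  let T : A →ₗ[F] (LinearMap.ker φ →ₗ[F] W) :=
    (LinearMap.domRestrict' (LinearMap.ker φ)).domRestrict A
  have hrange : LinearMap.range T = restrictKer A φ := LinearMap.range_domRestrict _ _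
  have h1 := finrank_restrictKer_add_finrank_slice A hφ
  rw [hs, finrank_bot, add_zero] at h1
  have hT : Function.Injective T := by
    have h2 := T.finrank_range_add_finrank_ker
    rw [hrange] at h2
    rw [← LinearMap.ker_eq_bot, ← Submodule.finrank_eq_zero (R := F)]
    omega
  have hfin : finrank F A = finrank F (LinearMap.ker φ →ₗ[F] W) := by
    rw [hdim, finrank_linearMap]
    congr 1
    omega
  let E := LinearEquiv.ofInjectiveOfFinrankEq T hT hfin
  let G : (LinearMap.ker φ →ₗ[F] W) →ₗ[F] W :=
    LinearMap.applyₗ e ∘ₗ A.subtype ∘ₗ E.symm.toLinearMap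
  have hE : ∀ X, (E.symm X : V →ₗ[F] W).domRestrict (LinearMap.ker φ) = X := fun X =>
    E.apply_symm_apply X
  -- An injective X already has rank w, so its extension in A has the same range, and that range
  -- contains the value at e. Hence this value is always X c, and all of A kills e - c.
  obtain ⟨c, hc⟩ := exists_forall_eq_apply_of_mem_range G (by omega) (by
    intro X hX
    have hle : LinearMap.range X ≤ LinearMap.range (E.symm X : V →ₗ[F] W) := by
      conv_lhs => rw [← hE X]
      exact LinearMap.range_domRestrict_le_range _ _
    have : LinearMap.range X = LinearMap.range (E.symm X : V →ₗ[F] W) := by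
      refine Submodule.eq_of_le_of_finrank_le hle ((hA _ (E.symm X).2).trans ?_)
      rw [LinearMap.finrank_range_of_inj hX]
      omega
    rw [this]
    exact ⟨e, rfl⟩)
  rw [Submodule.ne_bot_iff]
  refine ⟨e - c, fun f hf => ?_, fun h => ?_⟩
  · have h3 := hc (E ⟨f, hf⟩)
    have h4 : G (E ⟨f, hf⟩) = f e := by simp [G]
    rw [h4] at h3
    rw [map_sub, h3, sub_eq_zero]
    rfl
  · have := congrArg φ h
    simp [he] at this

section Step

variable {A : Submodule F (V →ₗ[F] W)} {w : ℕ} (hVW : finrank F V ≤ finrank F W)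
  (hA : ∀ f ∈ A, finrank F (LinearMap.range f) ≤ w) (hdim : finrank F A = w * finrank F W)
  (ih : ∀ φ : Dual F V, φ ≠ 0 → ∀ w' : ℕ,
    (∀ f ∈ restrictKer A φ, finrank F (LinearMap.range f) ≤ w') →
    finrank F (restrictKer A φ) = w' * finrank F W →
    finrank F V ≤ finrank F (commonKer (restrictKer A φ)) + w' + 1)

include hVW hA hdim ih

/-- Restriction is injective on A, so induction gives a common kernel inside the hyperplane,
possibly one dimension short. If A has no common kernel, `commonKer_ne_bot_of_slice_eq_bot` excludes
the shortfall. Otherwise take ψ with ψ u = 1 at a common kernel vector u: its slice is trivial too,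
and its hyperplane omits u, which supplies the missing dimension. -/
theorem le_finrank_commonKer_of_slice_eq_bot {φ : Dual F V} (hφ : φ ≠ 0) (hs : slice A φ = ⊥) :
    finrank F V ≤ finrank F (commonKer A) + w := by
  have hB : ∀ φ : Dual F V, φ ≠ 0 → slice A φ = ⊥ →
      finrank F V ≤ finrank F (commonKer (restrictKer A φ)) + w + 1 := by
    intro φ hφ hs
    have h1 := finrank_restrictKer_add_finrank_slice A hφ
    rw [hs, finrank_bot, add_zero, hdim] at h1
    exact ih φ hφ w (finrank_range_le_of_mem_restrictKer hA φ) h1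
  have h1 := hB φ hφ hs
  have h2 := finrank_commonKer_restrictKer_le A φ
  by_cases hK : commonKer A = ⊥
  · rw [hK, finrank_bot] at h2
    rcases Nat.lt_or_ge w (finrank F V) with h | h
    · exact absurd hK (commonKer_ne_bot_of_slice_eq_bot hVW (by omega) hA hdim hφ hs)
    · omega
  · obtain ⟨u, hu, hu0⟩ := Submodule.exists_mem_ne_zero_of_ne_bot hK
    obtain ⟨ψ, hψ⟩ := exists_dual_apply_eq_one (F := F) hu0
    have hψ0 : ψ ≠ 0 := by
      rintro rfl
      simp at hψ
    have hs' : slice A ψ = ⊥ := by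
      rw [eq_bot_iff]
      intro v hv
      simpa [hψ] using hu _ hv
    have h3 := hB ψ hψ0 hs'
    have h4 : (commonKer (restrictKer A ψ)).map (LinearMap.ker ψ).subtype < commonKer A := by
      refine lt_of_le_of_ne (map_commonKer_restrictKer_le A ψ) fun h => ?_
      rw [← h] at hu
      obtain ⟨x, -, rfl⟩ := hu
      have := x.2
      rw [LinearMap.mem_ker] at this
      simp [this] at hψ
    have h5 := Submodule.finrank_lt_finrank_of_lt h4
    rw [Submodule.finrank_map_subtype_eq] at h5
    omega

end Step

end Classification

/-! ### Classification: nontrivial slices and the conclusion -/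

section Classification

variable {F V W : Type*} [Field F]
  [AddCommGroup V] [Module F V] [AddCommGroup W] [Module F W]

theorem compRight_mkQ_surjective (S : Submodule F W) :
    Function.Surjective (LinearMap.compRight F S.mkQ : (V →ₗ[F] W) →ₗ[F] V →ₗ[F] W ⧸ S) := by
  obtain ⟨s, hs⟩ := S.mkQ.exists_rightInverse_of_surjective S.range_mkQ
  intro g
  refine ⟨s ∘ₗ g, ?_⟩
  rw [LinearMap.compRight_apply, ← LinearMap.comp_assoc, hs, LinearMap.id_comp]

variable [FiniteDimensional F V]

/-- For v in the slice, f and f + φ ⊗ v agree on ker φ, where the rank is already maximal. Both thus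
have the range of that restriction, which contains their values at e and so the difference v. -/
theorem slice_le_range_domRestrict {A : Submodule F (V →ₗ[F] W)} {w : ℕ}
    (hA : ∀ f ∈ A, finrank F (LinearMap.range f) ≤ w) {φ : Dual F V} (hφ : φ ≠ 0)
    {f : V →ₗ[F] W} (hf : f ∈ A)
    (hw : w ≤ finrank F (LinearMap.range (f.domRestrict (LinearMap.ker φ)))) :
    slice A φ ≤ LinearMap.range (f.domRestrict (LinearMap.ker φ)) := by
  intro v hv
  obtain ⟨e, he⟩ : ∃ e, φ e = 1 := LinearMap.surjective hφ 1
  have key : ∀ g ∈ A, g.domRestrict (LinearMap.ker φ) = f.domRestrict (LinearMap.ker φ) →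
      g e ∈ LinearMap.range (f.domRestrict (LinearMap.ker φ)) := by
    intro g hg hgf
    have hle : LinearMap.range (f.domRestrict (LinearMap.ker φ)) ≤ LinearMap.range g := by
      rw [← hgf]
      exact LinearMap.range_domRestrict_le_range _ _
    rw [Submodule.eq_of_le_of_finrank_le hle ((hA g hg).trans hw)]
    exact ⟨e, rfl⟩
  have h1 := key f hf rfl
  have h2 := key (f + φ.smulRight v) (A.add_mem hf hv) (by
    ext ⟨x, hx⟩
    simp [LinearMap.mem_ker.1 hx])
  have h3 := Submodule.sub_mem _ h2 h1
  simpa [he] using h3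

variable [FiniteDimensional F W]

theorem finrank_map_mkQ_lt {v : W} (hv : v ≠ 0) {R : Submodule F W} (hR : v ∈ R) :
    finrank F (R.map (F ∙ v).mkQ) < finrank F R := by
  have h := finrank_map_add_finrank_inf_ker R (F ∙ v).mkQ
  rw [Submodule.ker_mkQ, inf_eq_right.2 ((Submodule.span_singleton_le_iff_mem v R).2 hR),
    finrank_span_singleton hv] at h
  omega

section Step

variable [Finite F] {A : Submodule F (V →ₗ[F] W)} {w : ℕ} (hVW : finrank F V ≤ finrank F W)
  (hA : ∀ f ∈ A, finrank F (LinearMap.range f) ≤ w)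

include hVW hA

/-- Modulo a nonzero slice vector v, the restrictions have rank at most w - 1, since those of rank w
have v in their range. The anticode bound applies to maps into W / v; the maps into the line of v
lose at most dim V - 1 dimensions. -/
theorem finrank_le_of_slice_ne_bot (hw : 0 < w) {φ : Dual F V} (hφ : φ ≠ 0)
    (hs : slice A φ ≠ ⊥) :
    finrank F A + 1 ≤ (w - 1) * (finrank F W - 1) + finrank F V + finrank F (slice A φ) := by
  obtain ⟨v, hv, hv0⟩ := Submodule.exists_mem_ne_zero_of_ne_bot hs
  have hH := finrank_ker_dual_add_one hφ
  have hQ : finrank F (W ⧸ F ∙ v) + 1 = finrank F W := by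
    have := (F ∙ v).finrank_quotient_add_finrank
    rwa [finrank_span_singleton hv0] at this
  let C : (LinearMap.ker φ →ₗ[F] W) →ₗ[F] LinearMap.ker φ →ₗ[F] W ⧸ F ∙ v :=
    LinearMap.compRight F (F ∙ v).mkQ
  have hker : finrank F (LinearMap.ker C) = finrank F (LinearMap.ker φ) := by
    have h := C.finrank_range_add_finrank_ker
    rw [LinearMap.range_eq_top.2 (compRight_mkQ_surjective _), finrank_top, finrank_linearMap,
      finrank_linearMap, ← hQ] at h
    linarith
  have hmap : finrank F ((restrictKer A φ).map C) ≤ (w - 1) * finrank F (W ⧸ F ∙ v) := by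
    refine finrank_le_of_forall_finrank_range_le (by omega) ?_
    rintro _ ⟨_, ⟨f, hf, rfl⟩, rfl⟩
    change finrank F (LinearMap.range ((F ∙ v).mkQ ∘ₗ f.domRestrict (LinearMap.ker φ))) ≤ w - 1
    rw [LinearMap.range_comp]
    rcases Nat.lt_or_ge (finrank F (LinearMap.range (f.domRestrict (LinearMap.ker φ)))) w
      with h | h
    · exact (Submodule.finrank_map_le _ _).trans (by omega)
    · have h1 := finrank_map_mkQ_lt hv0 (slice_le_range_domRestrict hA hφ hf h hv)
      have h2 := finrank_range_le_of_mem_restrictKer hA φ _ ⟨f, hf, rfl⟩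
      change finrank F (LinearMap.range (f.domRestrict (LinearMap.ker φ))) ≤ w at h2
      omega
  have h1 := finrank_map_add_finrank_inf_ker (restrictKer A φ) C
  have h2 : finrank F (restrictKer A φ ⊓ LinearMap.ker C : Submodule F _) ≤
    finrank F (LinearMap.ker C) := Submodule.finrank_mono inf_le_right
  have h3 := finrank_restrictKer_add_finrank_slice A hφ
  rw [show finrank F W - 1 = finrank F (W ⧸ F ∙ v) by omega]
  omega

variable (hdim : finrank F A = w * finrank F W)

include hdim

/-- The restricted space has dimension at most (w - 1) * dim W and the slice at most dim W, so both
bounds are attained and induction applies with w - 1. -/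
theorem le_finrank_commonKer_of_finrank_range_domRestrict_lt
    (ih : ∀ φ : Dual F V, φ ≠ 0 → ∀ w' : ℕ,
      (∀ f ∈ restrictKer A φ, finrank F (LinearMap.range f) ≤ w') →
      finrank F (restrictKer A φ) = w' * finrank F W →
      finrank F V ≤ finrank F (commonKer (restrictKer A φ)) + w' + 1)
    {φ : Dual F V} (hφ : φ ≠ 0)
    (h : ∀ f ∈ A, finrank F (LinearMap.range (f.domRestrict (LinearMap.ker φ))) < w) :
    finrank F V ≤ finrank F (commonKer A) + w := by
  have hw := h 0 A.zero_mem
  obtain ⟨w', rfl⟩ := Nat.exists_eq_succ_of_ne_zero (Nat.ne_zero_of_lt hw)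
  have hB : ∀ g ∈ restrictKer A φ, finrank F (LinearMap.range g) ≤ w' := by
    rintro _ ⟨f, hf, rfl⟩
    exact Nat.le_of_lt_succ (h f hf)
  have hH := finrank_ker_dual_add_one hφ
  have h1 := finrank_le_of_forall_finrank_range_le (by omega) hB
  have h2 := finrank_restrictKer_add_finrank_slice A hφ
  have h3 := (slice A φ).finrank_le
  have h4 := finrank_commonKer_restrictKer_le A φ
  rw [hdim, Nat.succ_mul] at h2
  have h5 := ih φ hφ w' hB (by omega)
  omega

/-- The bounds on the slices force dim V = dim W and every slice to have dimension w. All slices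
then turn out to be the range U of one map M of rank w, so A consists of all the maps into U. -/
theorem exists_range_le_of_forall_slice_ne_bot (hw : 0 < w) (hwV : w < finrank F V)
    (hs : ∀ φ : Dual F V, φ ≠ 0 → slice A φ ≠ ⊥)
    (hr : ∀ φ : Dual F V, φ ≠ 0 →
      ∃ f ∈ A, w ≤ finrank F (LinearMap.range (f.domRestrict (LinearMap.ker φ)))) :
    finrank F V = finrank F W ∧
      ∃ U : Submodule F W, finrank F U ≤ w ∧ ∀ f ∈ A, LinearMap.range f ≤ U := by
  have hsle : ∀ φ : Dual F V, φ ≠ 0 → finrank F (slice A φ) ≤ w := by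
    intro φ hφ
    obtain ⟨f, hf, hfw⟩ := hr φ hφ
    exact (Submodule.finrank_mono (slice_le_range_domRestrict hA hφ hf hfw)).trans
      (finrank_range_le_of_mem_restrictKer hA φ _ ⟨f, hf, rfl⟩)
  have hsge : ∀ φ : Dual F V, φ ≠ 0 →
      w + finrank F W ≤ finrank F V + finrank F (slice A φ) := by
    intro φ hφ
    have h := finrank_le_of_slice_ne_bot hVW hA hw hφ (hs φ hφ)
    obtain ⟨a, ha⟩ := Nat.exists_eq_succ_of_ne_zero hw.ne'
    obtain ⟨b, hb⟩ := Nat.exists_eq_succ_of_ne_zero (n := finrank F W) (by omega)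
    rw [hdim, ha, hb] at h
    simp only [Nat.succ_eq_add_one, Nat.add_sub_cancel] at h
    rw [ha, hb]
    simp only [Nat.succ_eq_add_one]
    linarith
  have hV : Nontrivial V := finrank_pos_iff.1 (by omega : 0 < finrank F V)
  obtain ⟨x₀, hx₀⟩ := exists_ne (0 : V)
  obtain ⟨φ₀, hφ₀⟩ := exists_dual_apply_eq_one (F := F) hx₀
  have hφ₀' : φ₀ ≠ 0 := by
    rintro rfl
    simp at hφ₀
  have hm : finrank F V = finrank F W := by
    have := hsle φ₀ hφ₀'
    have := hsge φ₀ hφ₀'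
    omega
  obtain ⟨M, hM, hMw⟩ := hr φ₀ hφ₀'
  replace hMw := hMw.trans (Submodule.finrank_mono (LinearMap.range_domRestrict_le_range M _))
  obtain ⟨U, hU⟩ : ∃ U, U = LinearMap.range M := ⟨_, rfl⟩
  have hUw : finrank F U = w := hU ▸ le_antisymm (hA M hM) hMw
  have hkerM : LinearMap.ker M ≠ ⊥ := by
    intro h
    have h1 := M.finrank_range_add_finrank_ker
    rw [h, finrank_bot] at h1
    have h2 := hA M hM
    omega
  obtain ⟨k, hk, hk0⟩ := Submodule.exists_mem_ne_zero_of_ne_bot hkerM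
  rw [LinearMap.mem_ker] at hk
  -- As M k = 0 and k lies off ker φ, restricting M to ker φ keeps its whole range.
  have hgen : ∀ φ : Dual F V, φ k ≠ 0 → ∀ u ∈ U, φ.smulRight u ∈ A := by
    intro φ hφk
    have hφ : φ ≠ 0 := by
      rintro rfl
      simp at hφk
    have hrange : U ≤ LinearMap.range (M.domRestrict (LinearMap.ker φ)) := by
      rw [hU]
      rintro _ ⟨x, rfl⟩
      refine ⟨⟨x - (φ x / φ k) • k, ?_⟩, ?_⟩
      · simp [hφk]
      · simp [hk]
    have hle := (slice_le_range_domRestrict hA hφ hM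
      (hUw.ge.trans (Submodule.finrank_mono hrange))).trans
      (LinearMap.range_domRestrict_le_range M _)
    rw [← hU] at hle
    have hfin : finrank F U ≤ finrank F (slice A φ) := by
      have := hsge φ hφ
      omega
    have heq : slice A φ = U := Submodule.eq_of_le_of_finrank_le hle hfin
    intro u hu
    rw [← heq] at hu
    exact hu
  obtain ⟨φ₁, hφ₁⟩ := exists_dual_apply_eq_one (F := F) hk0
  have hall : ∀ φ : Dual F V, ∀ u ∈ U, φ.smulRight u ∈ A := by
    intro φ u hu
    by_cases h : φ k = 0
    · have h1 := hgen (φ + φ₁) (by simp [h, hφ₁]) u hu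
      have h2 := hgen φ₁ (by simp [hφ₁]) u hu
      have h3 := A.sub_mem h1 h2
      convert h3 using 1
      ext x
      simp [add_smul]
    · exact hgen φ h u hu
  let I : (V →ₗ[F] U) →ₗ[F] V →ₗ[F] W := LinearMap.compRight F U.subtype
  have hI : Function.Injective I := fun f g h => by
    ext x
    exact LinearMap.congr_fun h x
  have hIA : LinearMap.range I ≤ A := by
    rintro _ ⟨g, rfl⟩
    rw [eq_sum_coord_smulRight (finBasis F V) (I g)]
    exact A.sum_mem fun i _ => hall _ _ (g _).2
  have hIeq : LinearMap.range I = A := by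
    refine Submodule.eq_of_le_of_finrank_le hIA ?_
    rw [LinearMap.finrank_range_of_inj hI, finrank_linearMap, hUw, hdim, hm, mul_comm]
  refine ⟨hm, U, hUw.le, fun f hf => ?_⟩
  rw [← hIeq] at hf
  obtain ⟨g, rfl⟩ := hf
  rintro _ ⟨x, rfl⟩
  exact (g x).2

end Step

/-- A space of linear maps of rank at most `w` and of the largest possible dimension consists of
maps that vanish on a common subspace of codimension at most `w`, or of maps into a common subspace
of dimension at most `w`; the latter can only be needed for spaces of equal dimension. -/
theorem le_finrank_commonKer_or_exists_range_le [Finite F] {A : Submodule F (V →ₗ[F] W)} {w : ℕ}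
    (hVW : finrank F V ≤ finrank F W) (hA : ∀ f ∈ A, finrank F (LinearMap.range f) ≤ w)
    (hdim : finrank F A = w * finrank F W) :
    finrank F V ≤ finrank F (commonKer A) + w ∨ (finrank F V = finrank F W ∧
      ∃ U : Submodule F W, finrank F U ≤ w ∧ ∀ f ∈ A, LinearMap.range f ≤ U) := by
  induction hn : finrank F V generalizing V w with
  | zero => exact Or.inl (Nat.zero_le _)
  | succ n IH =>
    rw [hn] at hVW
    have ih : ∀ φ : Dual F V, φ ≠ 0 → ∀ w' : ℕ,
        (∀ f ∈ restrictKer A φ, finrank F (LinearMap.range f) ≤ w') →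
        finrank F (restrictKer A φ) = w' * finrank F W →
        finrank F V ≤ finrank F (commonKer (restrictKer A φ)) + w' + 1 := by
      intro φ hφ w' h1 h2
      have hH := finrank_ker_dual_add_one hφ
      -- A hyperplane has dimension less than dim W, so only the common-kernel alternative survives.
      rcases IH (by omega) h1 h2 (by omega) with h | ⟨h, -⟩ <;> omega
    rcases Nat.lt_or_ge w (finrank F V) with hwV | hwV
    swap
    · left
      omega
    rcases Nat.eq_zero_or_pos w with rfl | hw
    · left
      have : commonKer A = ⊤ := by
        rw [eq_top_iff]
        intro x _ f hf
        have h := Submodule.finrank_eq_zero.1 (Nat.le_zero.1 (hA f hf))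
        rw [LinearMap.range_eq_bot.1 h, LinearMap.zero_apply]
      rw [this, finrank_top, hn, add_zero]
    by_cases h1 : ∃ φ : Dual F V, φ ≠ 0 ∧ slice A φ = ⊥
    · obtain ⟨φ, hφ, hs⟩ := h1
      left
      rw [← hn]
      exact le_finrank_commonKer_of_slice_eq_bot (hn ▸ hVW) hA hdim ih hφ hs
    by_cases h2 : ∃ φ : Dual F V, φ ≠ 0 ∧
        ∀ f ∈ A, finrank F (LinearMap.range (f.domRestrict (LinearMap.ker φ))) < w
    · obtain ⟨φ, hφ, hs⟩ := h2
      left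
      rw [← hn]
      exact le_finrank_commonKer_of_finrank_range_domRestrict_lt (hn ▸ hVW) hA hdim ih hφ hs
    right
    push Not at h1 h2
    rw [← hn]
    exact exists_range_le_of_forall_slice_ne_bot (hn ▸ hVW) hA hdim hw hwV h1 h2

end Classification

/-! ### Optimal anticodes inside optimal anticodes -/

section Subanticode

variable {F V W : Type*} [Field F] [Finite F]
  [AddCommGroup V] [Module F V] [AddCommGroup W] [Module F W]
  [FiniteDimensional F V] [FiniteDimensional F W]

/-- By the classification, it suffices to impose vanishing at one more vector u, or that the range
lie in the kernel of a functional ψ nonzero on U. The cost is at most dim W, respectively dim V =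
dim W. -/
theorem exists_le_forall_finrank_range_le {A : Submodule F (V →ₗ[F] W)} {w : ℕ}
    (hVW : finrank F V ≤ finrank F W) (hW : 0 < finrank F W)
    (hA : ∀ f ∈ A, finrank F (LinearMap.range f) ≤ w + 1)
    (hdim : finrank F A = (w + 1) * finrank F W) :
    ∃ A' ≤ A, (∀ f ∈ A', finrank F (LinearMap.range f) ≤ w) ∧
      w * finrank F W ≤ finrank F A' := by
  have hA0 : ∃ f ∈ A, f ≠ 0 := by
    rw [← Submodule.ne_bot_iff]
    rintro rfl
    rw [finrank_bot] at hdim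
    have : 0 < (w + 1) * finrank F W := by positivity
    omega
  obtain ⟨f₀, hf₀, hf₀0⟩ := hA0
  rw [Nat.succ_mul] at hdim
  rcases le_finrank_commonKer_or_exists_range_le hVW hA (by rw [hdim, Nat.succ_mul]) with
    hK | ⟨hm, U, hUw, hU⟩
  · obtain ⟨u, hu⟩ : ∃ u, f₀ u ≠ 0 := by
      by_contra! h
      exact hf₀0 (LinearMap.ext h)
    refine ⟨A ⊓ LinearMap.ker (LinearMap.applyₗ u), inf_le_left, ?_, ?_⟩
    · rintro f ⟨hf, hfu⟩
      have hlt : commonKer A < LinearMap.ker f := by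
        refine lt_of_le_of_ne (fun x hx => hx f hf) fun h => hu ?_
        have : u ∈ LinearMap.ker f := hfu
        rw [← h] at this
        exact this f₀ hf₀
      have h1 := Submodule.finrank_lt_finrank_of_lt hlt
      have h2 := f.finrank_range_add_finrank_ker
      omega
    · have h1 := finrank_map_add_finrank_inf_ker A
        (LinearMap.applyₗ u : (V →ₗ[F] W) →ₗ[F] W)
      have h2 := (A.map (LinearMap.applyₗ u : (V →ₗ[F] W) →ₗ[F] W)).finrank_le
      omega
  · obtain ⟨x, hx⟩ : ∃ x, f₀ x ≠ 0 := by
      by_contra! h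
      exact hf₀0 (LinearMap.ext h)
    obtain ⟨ψ, hψ⟩ := exists_dual_apply_eq_one (F := F) hx
    let T : (V →ₗ[F] W) →ₗ[F] V →ₗ[F] F := LinearMap.compRight F ψ
    refine ⟨A ⊓ LinearMap.ker T, inf_le_left, ?_, ?_⟩
    · rintro f ⟨hf, hfψ⟩
      have hlt : LinearMap.range f < U := by
        refine lt_of_le_of_ne (hU f hf) fun h => ?_
        have h1 : f₀ x ∈ U := hU f₀ hf₀ ⟨x, rfl⟩
        rw [← h] at h1
        obtain ⟨y, hy⟩ := h1
        have h2 : ψ (f y) = 0 := LinearMap.congr_fun (LinearMap.mem_ker.1 hfψ) y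
        rw [hy, hψ] at h2
        exact one_ne_zero h2
      have h1 := Submodule.finrank_lt_finrank_of_lt hlt
      omega
    · have h1 := finrank_map_add_finrank_inf_ker A T
      have h2 := (A.map T).finrank_le
      rw [finrank_linearMap_self] at h2
      omega

end Subanticode

/-! ### Growth of the generalized weights -/

section Matrix

variable {F : Type*} [Field F] {m n : ℕ}

theorem maxRank_le_iff {C : Submodule F (Matrix (Fin m) (Fin n) F)} {w : ℕ} :
    maxRank C ≤ w ↔ ∀ M ∈ C, M.rank ≤ w := by
  refine ⟨fun h M hM => ((isGreatest_maxRank C).2 ⟨M, hM, rfl⟩).trans h, fun h => ?_⟩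
  obtain ⟨M, hM, hr⟩ := (isGreatest_maxRank C).1
  exact hr ▸ h M hM

theorem finrank_range_toLin' (M : Matrix (Fin m) (Fin n) F) :
    finrank F (LinearMap.range M.toLin') = M.rank := rfl

theorem forall_mem_map_toLin' {C : Submodule F (Matrix (Fin m) (Fin n) F)} {w : ℕ} :
    (∀ f ∈ C.map (Matrix.toLin' : Matrix (Fin m) (Fin n) F ≃ₗ[F] _).toLinearMap,
      finrank F (LinearMap.range f) ≤ w) ↔ maxRank C ≤ w := by
  rw [maxRank_le_iff]
  constructor
  · exact fun h M hM => h _ ⟨M, hM, rfl⟩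
  · rintro h _ ⟨M, hM, rfl⟩
    exact h M hM

theorem finrank_le_of_maxRank_le [Finite F] (hnm : n ≤ m)
    {C : Submodule F (Matrix (Fin m) (Fin n) F)} {w : ℕ} (h : maxRank C ≤ w) :
    finrank F C ≤ m * w := by
  have := finrank_le_of_forall_finrank_range_le (by simpa using hnm) (forall_mem_map_toLin'.2 h)
  rwa [LinearEquiv.finrank_map_eq, finrank_fin_fun, mul_comm] at this

/-- The anticode bound gives m * w ≤ dim A ≤ m * maxRank A, and equality follows throughout. -/
theorem isOptimalAnticode_and_maxRank_eq [Finite F] (hm : 0 < m) (hnm : n ≤ m)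
    {A : Submodule F (Matrix (Fin m) (Fin n) F)} {w : ℕ} (h : maxRank A ≤ w)
    (hdim : m * w ≤ finrank F A) : IsOptimalAnticode A ∧ maxRank A = w := by
  have h1 := finrank_le_of_maxRank_le hnm (le_refl (maxRank A))
  have h2 : maxRank A = w := le_antisymm h (Nat.le_of_mul_le_mul_left (hdim.trans h1) hm)
  exact ⟨le_antisymm h1 (h2 ▸ hdim), h2⟩

theorem IsOptimalAnticode.exists_le [Finite F] (hm : 0 < m) (hnm : n ≤ m)
    {A : Submodule F (Matrix (Fin m) (Fin n) F)} {w : ℕ} (hA : IsOptimalAnticode A)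
    (hw : maxRank A = w + 1) : ∃ A' ≤ A, IsOptimalAnticode A' ∧ maxRank A' = w := by
  obtain ⟨B, hB, hBw, hdim⟩ := exists_le_forall_finrank_range_le
    (A := A.map (Matrix.toLin' : Matrix (Fin m) (Fin n) F ≃ₗ[F] _).toLinearMap) (w := w)
    (by simpa using hnm) (by simpa using hm) (forall_mem_map_toLin'.2 hw.le)
    (by rw [LinearEquiv.finrank_map_eq, finrank_fin_fun, hA, hw, mul_comm])
  let A' : Submodule F (Matrix (Fin m) (Fin n) F) :=
    B.comap (Matrix.toLin' : Matrix (Fin m) (Fin n) F ≃ₗ[F] _).toLinearMap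
  have hmap : A'.map (Matrix.toLin' : Matrix (Fin m) (Fin n) F ≃ₗ[F] _).toLinearMap = B :=
    Submodule.map_comap_eq_of_surjective (LinearEquiv.surjective _) B
  refine ⟨A', ?_, isOptimalAnticode_and_maxRank_eq hm hnm ?_ ?_⟩
  · intro M hM
    obtain ⟨N, hN, hNM⟩ := hB hM
    rwa [← (LinearEquiv.injective _ hNM : N = M)]
  · rw [← forall_mem_map_toLin', hmap]
    exact hBw
  · rw [← hmap, LinearEquiv.finrank_map_eq, finrank_fin_fun] at hdim
    rwa [mul_comm]

theorem genWeight_le (hnm : n ≤ m) (C : Submodule F (Matrix (Fin m) (Fin n) F)) {r : ℕ}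
    (hr : r ≤ finrank F C) : genWeight C r ≤ n :=
  ((isLeast_genWeight C hr).2 ⟨C, le_rfl, hr, rfl⟩).trans
    ((isLeast_weight hnm C).2 ⟨⊤, le_top, isOptimalAnticode_top hnm, maxRank_top hnm⟩)

theorem genWeight_lt_genWeight_add [Finite F] (hm : 0 < m) (hnm : n ≤ m)
    (C : Submodule F (Matrix (Fin m) (Fin n) F)) {r : ℕ} (hr : r + m ≤ finrank F C) :
    genWeight C r < genWeight C (r + m) := by
  obtain ⟨D, hDC, hD, hDw⟩ := (isLeast_genWeight C hr).1
  obtain ⟨A, hDA, hA, hAw⟩ := (isLeast_weight hnm D).1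
  rw [← hDw, ← hAw]
  have hfA : finrank F A = m * maxRank A := hA
  have hDA' := Submodule.finrank_mono hDA
  obtain ⟨w, hw⟩ : ∃ w, maxRank A = w + 1 := by
    refine Nat.exists_eq_succ_of_ne_zero fun h => ?_
    rw [h, mul_zero] at hfA
    omega
  obtain ⟨A', hA'A, hA', hA'w⟩ := hA.exists_le hm hnm hw
  have hfA' : finrank F A' = m * maxRank A' := hA'
  have h1 := Submodule.finrank_sup_add_finrank_inf_eq D A'
  have h2 := Submodule.finrank_mono (sup_le hDA hA'A)
  rw [hfA, hw, Nat.mul_succ] at h2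
  rw [hfA', hA'w] at h1
  have h3 : weight (D ⊓ A') ≤ w := (isLeast_weight hnm _).2 ⟨A', inf_le_right, hA', hA'w⟩
  have h4 : genWeight C r ≤ weight (D ⊓ A') :=
    (isLeast_genWeight C (by omega)).2 ⟨_, inf_le_left.trans hDC, by omega, rfl⟩
  omega

end Matrix

/-! ### Construction of a code with prescribed weights -/

section Construction

variable {F L : Type*} [Field F] [Field L] [Algebra F L] {n : ℕ}

/-- Evaluation at the unit vectors from the `w`-th one on. -/
def evalFrom (F L : Type*) [Field F] [Field L] [Algebra F L] (n w : ℕ) :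
    ((Fin n → F) →ₗ[F] L) →ₗ[L] Fin (n - w) → L where
  toFun f l := f (Pi.single ⟨w + l, by omega⟩ 1)
  map_add' _ _ := rfl
  map_smul' _ _ := rfl

theorem mem_ker_evalFrom {w : ℕ} {f : (Fin n → F) →ₗ[F] L} :
    f ∈ LinearMap.ker (evalFrom F L n w) ↔ ∀ l : Fin n, w ≤ l → f (Pi.single l 1) = 0 := by
  rw [LinearMap.mem_ker]
  constructor
  · intro h l hl
    have := congrFun h ⟨l - w, by omega⟩
    simpa [evalFrom, Nat.add_sub_cancel' hl] using this
  · intro h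
    funext l
    exact h _ (Nat.le_add_right _ _)

theorem ker_evalFrom_mono {v w : ℕ} (h : v ≤ w) :
    LinearMap.ker (evalFrom F L n v) ≤ LinearMap.ker (evalFrom F L n w) := by
  intro f hf
  rw [mem_ker_evalFrom] at hf ⊢
  exact fun l hl => hf l (h.trans hl)

theorem finrank_range_le_of_mem_ker_evalFrom {w : ℕ} {f : (Fin n → F) →ₗ[F] L}
    (hf : f ∈ LinearMap.ker (evalFrom F L n w)) : finrank F (LinearMap.range f) ≤ w := by
  classical
  rw [mem_ker_evalFrom] at hf
  let s : Finset L := (Finset.univ.filter fun l : Fin n => (l : ℕ) < w).image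
    fun l => f (Pi.single l 1)
  have hle : LinearMap.range f ≤ Submodule.span F (s : Set L) := by
    rintro _ ⟨x, rfl⟩
    rw [LinearMap.pi_apply_eq_sum_univ f x]
    refine Submodule.sum_mem _ fun l _ => Submodule.smul_mem _ _ ?_
    have hl : (fun j => if l = j then (1 : F) else 0) = Pi.single l 1 := by
      ext j
      simp [Pi.single_apply, eq_comm]
    rw [hl]
    rcases Nat.lt_or_ge l w with h | h
    · exact Submodule.subset_span (Finset.mem_coe.2 (Finset.mem_image_of_mem _ (by simpa using h)))
    · rw [hf l h]
      exact Submodule.zero_mem _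
  have : FiniteDimensional F (Submodule.span F (s : Set L)) :=
    FiniteDimensional.span_finset F s
  refine (Submodule.finrank_mono hle).trans ((finrank_span_finset_le_card s).trans ?_)
  refine Finset.card_image_le.trans ?_
  rw [← Finset.card_range w]
  refine Finset.card_le_card_of_injOn (fun l => (l : ℕ)) (fun l hl => ?_)
    (Fin.val_injective.injOn)
  simpa using hl

theorem mul_le_finrank_ker_evalFrom [FiniteDimensional F L] {w : ℕ} (hw : w ≤ n) :
    finrank F L * w ≤
      finrank F ((LinearMap.ker (evalFrom F L n w)).restrictScalars F) := by
  have : Module.Free L (LinearMap.ker (evalFrom F L n w)) :=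
    Module.Free.of_divisionRing L (LinearMap.ker (evalFrom F L n w))
  refine le_trans (Nat.mul_le_mul_left _ ?_)
    (Module.finrank_mul_finrank F L (LinearMap.ker (evalFrom F L n w))).le
  have h1 := (evalFrom F L n w).finrank_range_add_finrank_ker
  have h2 := (LinearMap.range (evalFrom F L n w)).finrank_le
  rw [finrank_linearMap_self, finrank_fin_fun] at h1
  rw [finrank_fin_fun] at h2
  omega

variable [Fintype F]

/-- Membership in the kernel imposes n - j - 1 linear conditions over L on a space of dimension n -
j. -/
theorem exists_mem_gabidulin_mem_ker_evalFrom {α : (Fin n → F) →ₗ[F] L}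
    (hα : Function.Injective α) (j : Fin n) :
    ∃ g ∈ gabidulin α (n - j), g ≠ 0 ∧ g ∈ LinearMap.ker (evalFrom F L n (j + 1)) := by
  have hlt : finrank L (Fin (n - (j + 1)) → L) < finrank L (gabidulin α (n - j)) := by
    rw [finrank_gabidulin hα (by simp), finrank_fin_fun]
    omega
  have h := LinearMap.ker_ne_bot_of_finrank_lt (K := L) (V := gabidulin α (n - j))
    (f := (evalFrom F L n (j + 1)).domRestrict (gabidulin α (n - j))) hlt
  obtain ⟨⟨g, hg⟩, hgk, hg0⟩ := Submodule.exists_mem_ne_zero_of_ne_bot h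
  exact ⟨g, hg, fun h => hg0 (Subtype.ext h), hgk⟩

/-- In a relation, the term of largest index j would lie in E_j and have rank at most j, while g_j
has kernel of dimension less than n - j. -/
theorem linearIndependent_of_mem_gabidulin {α : (Fin n → F) →ₗ[F] L}
    (hα : Function.Injective α) {g : Fin n → (Fin n → F) →ₗ[F] L}
    (hg : ∀ j : Fin n, g j ∈ gabidulin α (n - j)) (hg0 : ∀ j, g j ≠ 0)
    (hgE : ∀ j : Fin n, g j ∈ LinearMap.ker (evalFrom F L n (j + 1))) :
    LinearIndependent L g := by
  classical
  rw [Fintype.linearIndependent_iff]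
  intro a ha
  by_contra! hne
  obtain ⟨i, hi⟩ := hne
  let s : Finset (Fin n) := Finset.univ.filter fun j => a j ≠ 0
  have hs : s.Nonempty := ⟨i, by simpa [s] using hi⟩
  set j := s.max' hs with hj
  have haj : a j ≠ 0 := by simpa [s] using s.max'_mem hs
  have hsum : a j • g j ∈ LinearMap.ker (evalFrom F L n j) := by
    rw [← Finset.add_sum_erase _ _ (Finset.mem_univ j), add_eq_zero_iff_eq_neg] at ha
    rw [ha]
    refine Submodule.neg_mem _ (Submodule.sum_mem _ fun l hl => ?_)
    by_cases hal : a l = 0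
    · rw [hal, zero_smul]
      exact Submodule.zero_mem _
    · have hlj : l < j := lt_of_le_of_ne (s.le_max' l (by simpa [s] using hal))
        (Finset.ne_of_mem_erase hl)
      exact Submodule.smul_mem _ _ (ker_evalFrom_mono (Nat.succ_le_of_lt hlj) (hgE l))
  rw [Submodule.smul_mem_iff _ haj] at hsum
  have h1 := finrank_range_le_of_mem_ker_evalFrom hsum
  have h2 := finrank_ker_lt_of_mem_gabidulin hα (hg j) (hg0 j)
  have h3 := (g j).finrank_range_add_finrank_ker
  rw [finrank_fin_fun] at h3
  omega

theorem exists_code_of_fibers_card_le [FiniteDimensional F L] (hn : n ≤ finrank F L) {k : ℕ}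
    {d : Fin k → ℕ} (hmono : Monotone d) (hpos : ∀ i, 0 < d i) (hd : ∀ i, d i ≤ n)
    (hfib : ∀ c, Fintype.card {i // d i = c} ≤ finrank F L) :
    ∃ C : Submodule F ((Fin n → F) →ₗ[F] L), finrank F C = k ∧
      (∀ i : Fin k, ∃ D ≤ C, finrank F D = (i : ℕ) + 1 ∧
        D ≤ (LinearMap.ker (evalFrom F L n (d i))).restrictScalars F) ∧
      ∀ i : Fin k, ∀ D ≤ C, ∀ w < d i, (∀ f ∈ D, finrank F (LinearMap.range f) ≤ w) →
        finrank F D ≤ i := by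
  obtain ⟨α, hα⟩ : ∃ α : (Fin n → F) →ₗ[F] L, Function.Injective α :=
    finrank_le_iff_exists_linearMap.1 (by simpa using hn)
  choose g hg hg0 hgE using exists_mem_gabidulin_mem_ker_evalFrom hα
  have hemb : ∀ c, ∃ τ : {i // d i = c} → Fin (finrank F L), Function.Injective τ := by
    intro c
    obtain ⟨τ⟩ := Function.Embedding.nonempty_of_card_le
      (α := {i // d i = c}) (β := Fin (finrank F L)) (by simpa using hfib c)
    exact ⟨τ, τ.injective⟩
  choose τ hτ using hemb
  have hτ' : ∀ c i j (hi : d i = c) (hj : d j = c), τ c ⟨i, hi⟩ = τ c ⟨j, hj⟩ → i = j :=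
    fun c i j hi hj h => congrArg Subtype.val (hτ c h)
  let δ : Fin k → Fin n := fun i => ⟨d i - 1, by have := hpos i; have := hd i; omega⟩
  have hδ : ∀ i, (δ i : ℕ) + 1 = d i := fun i => Nat.sub_add_cancel (hpos i)
  -- The x l with l ≤ i lie in E_{d_i}. Those with l ≥ i lie in G_{n-w} for every w < d_i, so they
  -- span a space of dimension k - i that is disjoint from any D of rank at most w.
  let x : Fin k → (Fin n → F) →ₗ[F] L := fun i =>
    finBasis F L (τ (d i) ⟨i, rfl⟩) • g (δ i)
  have hx : LinearIndependent F x := by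
    refine (linearIndependent_smul (finBasis F L).linearIndependent
      (linearIndependent_of_mem_gabidulin hα hg hg0 hgE)).comp
      (fun i => (τ (d i) ⟨i, rfl⟩, δ i)) fun i j hij => ?_
    obtain ⟨h1, h2⟩ := Prod.mk.inj hij
    have h3 : d i = d j := by rw [← hδ, ← hδ, h2]
    refine hτ' (d j) i j h3 rfl ?_
    rw [← h1]
    have h4 : ∀ c c' (h : d i = c) (h' : d i = c'), c = c' →
        τ c ⟨i, h⟩ = τ c' ⟨i, h'⟩ := by
      rintro c _ h h' rfl
      rfl
    exact h4 _ _ _ _ h3.symm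
  refine ⟨Submodule.span F (Set.range x), ?_, fun i => ?_, fun i D hD w hw hDw => ?_⟩
  · rw [finrank_span_eq_card hx, Fintype.card_fin]
  · let y : {l : Fin k // l ≤ i} → (Fin n → F) →ₗ[F] L := fun l => x l
    have hy : LinearIndependent F y := hx.comp _ Subtype.val_injective
    refine ⟨Submodule.span F (Set.range y), Submodule.span_mono ?_, ?_, ?_⟩
    · rintro _ ⟨l, rfl⟩
      exact ⟨l, rfl⟩
    · rw [finrank_span_eq_card hy]
      rw [Fintype.card_subtype, ← Fin.card_Iic i]
      congr 1
      ext l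
      simp
    · rw [Submodule.span_le]
      rintro _ ⟨l, rfl⟩
      refine Submodule.smul_mem _ _ (ker_evalFrom_mono ?_ (hgE _))
      rw [hδ]
      exact hmono l.2
  · let y : {l : Fin k // i ≤ l} → (Fin n → F) →ₗ[F] L := fun l => x l
    have hy : LinearIndependent F y := hx.comp _ Subtype.val_injective
    have hyG : Submodule.span F (Set.range y) ≤ (gabidulin α (n - w)).restrictScalars F := by
      rw [Submodule.span_le]
      rintro _ ⟨l, rfl⟩
      refine Submodule.smul_mem _ _ (gabidulin_mono α ?_ (hg _))
      have h1 := hδ l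
      have h2 := hmono l.2
      omega
    have hdis : Disjoint D (Submodule.span F (Set.range y)) := by
      have := disjoint_gabidulin hα hDw
      rw [finrank_fin_fun] at this
      exact this.mono_right hyG
    have h1 := Submodule.finrank_sup_add_finrank_inf_eq D (Submodule.span F (Set.range y))
    rw [hdis.eq_bot, finrank_bot, finrank_span_eq_card hy] at h1
    have h2 : finrank F (D ⊔ Submodule.span F (Set.range y) : Submodule F _) ≤
        finrank F (Submodule.span F (Set.range x)) := by
      refine Submodule.finrank_mono (sup_le hD (Submodule.span_mono ?_))
      rintro _ ⟨l, rfl⟩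
      exact ⟨l, rfl⟩
    rw [finrank_span_eq_card hx, Fintype.card_fin] at h2
    have h3 : Fintype.card {l : Fin k // i ≤ l} = k - i := by
      rw [Fintype.card_subtype]
      rw [← Fin.card_Ici i]
      congr 1
      ext l
      simp
    omega

end Construction

theorem exists_add_le_of_lt_card {k m : ℕ} {S : Finset (Fin k)} (h : m < S.card) :
    ∃ i ∈ S, ∃ j ∈ S, (i : ℕ) + m ≤ j := by
  have hS : S.Nonempty := Finset.card_pos.1 (by omega)
  refine ⟨S.min' hS, S.min'_mem hS, S.max' hS, S.max'_mem hS, ?_⟩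
  have hle : S ⊆ Finset.Icc (S.min' hS) (S.max' hS) := fun x hx =>
    Finset.mem_Icc.2 ⟨S.min'_le x hx, S.le_max' x hx⟩
  have := Finset.card_le_card hle
  rw [Fin.card_Icc] at this
  omega

/-- Every sequence of admissible weights is the sequence of generalized rank weights of a code. -/
theorem exists_isGenWeightSequence {F : Type*} [Field F] [Finite F] {m n k : ℕ} (hm : 0 < m)
    (hnm : n ≤ m) {d : Fin k → ℕ} (hmono : Monotone d) (hpos : ∀ i, 0 < d i) (hd : ∀ i, d i ≤ n)
    (hfib : ∀ c, Fintype.card {i // d i = c} ≤ m) :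
    ∃ C : Submodule F (Matrix (Fin m) (Fin n) F), IsGenWeightSequence C d := by
  have := Fintype.ofFinite F
  obtain ⟨L, _, _, _, rfl⟩ := exists_extension_finrank_eq F hm
  obtain ⟨C, hCk, hC₁, hC₂⟩ := exists_code_of_fibers_card_le hnm hmono hpos hd hfib
  let Φ : Matrix (Fin (finrank F L)) (Fin n) F ≃ₗ[F] ((Fin n → F) →ₗ[F] L) :=
    Matrix.toLin' ≪≫ₗ LinearEquiv.congrRight (finBasis F L).equivFun.symm
  have hΦ : ∀ M, finrank F (LinearMap.range (Φ M)) = M.rank := by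
    intro M
    change finrank F (LinearMap.range
      ((finBasis F L).equivFun.symm.toLinearMap ∘ₗ M.toLin')) = _
    rw [LinearMap.range_comp, LinearEquiv.finrank_map_eq, finrank_range_toLin']
  refine ⟨C.map Φ.symm.toLinearMap, ?_, fun i => ?_⟩
  · rw [LinearEquiv.finrank_map_eq, hCk]
  apply le_antisymm
  · obtain ⟨D, hDC, hD, hDE⟩ := hC₁ i
    let E := ((LinearMap.ker (evalFrom F L n (d i))).restrictScalars F).map Φ.symm.toLinearMap
    have hE : IsOptimalAnticode E ∧ maxRank E = d i := by
      refine isOptimalAnticode_and_maxRank_eq hm hnm ?_ ?_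
      · rw [maxRank_le_iff]
        rintro _ ⟨f, hf, rfl⟩
        rw [← hΦ]
        change finrank F (LinearMap.range (Φ (Φ.symm f))) ≤ _
        rw [Φ.apply_symm_apply]
        exact finrank_range_le_of_mem_ker_evalFrom hf
      · rw [LinearEquiv.finrank_map_eq]
        exact mul_le_finrank_ker_evalFrom (hd i)
    have h1 : weight (D.map Φ.symm.toLinearMap) ≤ d i :=
      (isLeast_weight hnm _).2 ⟨E, Submodule.map_mono hDE, hE⟩
    refine le_trans (Nat.sInf_le ⟨D.map Φ.symm.toLinearMap, Submodule.map_mono hDC, ?_, rfl⟩) h1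
    rw [LinearEquiv.finrank_map_eq, hD]
  · have hk : (i : ℕ) + 1 ≤ finrank F (C.map Φ.symm.toLinearMap) := by
      rw [LinearEquiv.finrank_map_eq, hCk]
      exact i.2
    obtain ⟨D, hDC, hD, hDw⟩ := (isLeast_genWeight _ hk).1
    -- The lower bound needs only the ranks in A, not its optimality.
    obtain ⟨A, hDA, -, hAw⟩ := (isLeast_weight hnm D).1
    rw [← hDw, ← hAw]
    by_contra! hlt
    have h1 := hC₂ i (D.map Φ.toLinearMap) (by
      rintro _ ⟨M, hM, rfl⟩
      obtain ⟨f, hf, rfl⟩ := hDC hM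
      change Φ (Φ.symm f) ∈ C
      rwa [Φ.apply_symm_apply]) _ hlt (by
      rintro _ ⟨M, hM, rfl⟩
      exact (hΦ M).le.trans ((isGreatest_maxRank A).2 ⟨M, hDA hM, rfl⟩))
    rw [LinearEquiv.finrank_map_eq] at h1
    omega

end RankMetric

theorem theorem4p8 {F : Type*} [Field F] [Finite F] (m n : ℕ) (hn : 1 ≤ n) (hnm : n ≤ m)
    (k : ℕ) (d : Fin k → ℕ) (hmono : Monotone d) (hpos : ∀ i, 0 < d i) :
    (∃ C : Submodule F (Matrix (Fin m) (Fin n) F), RankMetric.IsGenWeightSequence C d) ↔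
      k ≤ m * n ∧
      (∀ hk : 0 < k, d ⟨k - 1, Nat.sub_lt hk Nat.one_pos⟩ ≤ n) ∧
      (∀ S : Finset (Fin k), (∀ i ∈ S, ∀ j ∈ S, d i = d j) → S.card ≤ m) := by
  have hm : 0 < m := hn.trans hnm
  constructor
  · rintro ⟨C, hC, hd⟩
    refine ⟨?_, fun hk => ?_, fun S hS => ?_⟩
    · rw [← hC]
      refine C.finrank_le.trans ?_
      simp [Module.finrank_matrix]
    · rw [← hd]
      exact RankMetric.genWeight_le hnm C (by rw [hC]; exact Nat.sub_lt hk Nat.one_pos)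
    · by_contra! hlt
      obtain ⟨i, hi, j, hj, hij⟩ := RankMetric.exists_add_le_of_lt_card hlt
      -- Strict growth gives d i < d (i + m), but monotonicity and i + m ≤ j give d (i + m) ≤ d j =
      -- d i.
      have h1 := RankMetric.genWeight_lt_genWeight_add hm hnm C (r := i + 1) (by omega)
      rw [hd i, hS i hi j hj, show (i : ℕ) + 1 + m = i + m + 1 by omega] at h1
      have h2 := hd ⟨i + m, hij.trans_lt j.2⟩
      have h3 : d ⟨i + m, hij.trans_lt j.2⟩ ≤ d j := hmono hij
      simp only at h2
      omega
  · rintro ⟨-, hd, hS⟩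
    refine RankMetric.exists_isGenWeightSequence hm hnm hmono hpos (fun i => ?_) fun c => ?_
    · exact (hmono (show i ≤ ⟨k - 1, Nat.sub_lt i.pos Nat.one_pos⟩ from
        Nat.le_sub_one_of_lt i.2)).trans (hd i.pos)
    · rw [Fintype.card_subtype]
      refine hS _ fun i hi j hj => ?_
      rw [(Finset.mem_filter.1 hi).2, (Finset.mem_filter.1 hj).2]
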